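/- Conventions. For a unital C*-algebra $\mathfrak A$ let $\mathfrak{sa}(\mathfrak A)$ be its self-adjoint part and $\mathscr S(\mathfrak A)$ its state space. A seminorm $\mathsf L$ defined on a subspace of $\mathfrak{sa}(\mathfrak A)$ is extended by $\infty$ off this subspace. $\mathsf L$ is a Lip-norm, and $(\mathfrak A,\mathsf L)$ a quantum compact metric space, when its domain is norm-dense in $\mathfrak{sa}(\mathfrak A)$, $\{a:\mathsf L(a)=0\}=\mathbb R1_{\mathfrak A}$, $\{a:\mathsf L(a)\le 1\}$ is norm-closed, and the Monge–Kantorovich metric $\mathsf{mk}_{\mathsf L}(\varphi,\psi)=\sup\{|\varphi(a)-\psi(a)|:a\in\mathfrak{sa}(\mathfrak A),\ \mathsf L(a)\le1\}$ metrizes the weak* topology of $\mathscr S(\mathfrak A)$. For a function $F:[0,\infty)^4\to[0,\infty)$ that is increasing for the product order, $(\mathfrak A,\mathsf L)$ is $F$-Leibniz when moreover $$\max\left\{\mathsf L\left(\tfrac{ab+ba}{2}\right),\mathsf L\left(\tfrac{ab-ba}{2i}\right)\right\}\le F(\|a\|,\|b\|,\mathsf L(a),\mathsf L(b))$$ for all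 $a,b\in\mathfrak{sa}(\mathfrak A)$ in the domain of $\mathsf L$. An $F$-tunnel between two $F$-Leibniz quantum compact metric spaces $(\mathfrak A_1,\mathsf L_1)$ and $(\mathfrak A_2,\mathsf L_2)$ consists of an $F$-Leibniz quantum compact metric space $(\mathfrak D,\mathsf L)$ and unital surjective *-morphisms $\pi_j:\mathfrak D\to\mathfrak A_j$ such that $\mathsf L_j(a)=\inf\{\mathsf L(d): d\in\mathfrak{sa}(\mathfrak D),\ \pi_j(d)=a\}$ for all $a\in\mathfrak{sa}(\mathfrak A_j)$, $j=1,2$; its extent is the maximum over $j$ of the Hausdorff distance, for $\mathsf{mk}_{\mathsf L}$, between $\mathscr S(\mathfrak D)$ and $\{\varphi\circ\pi_j:\varphi\in\mathscr S(\mathfrak A_j)\}$. The propinquity $\mathsf\Lambda^*_F$ is the infimum of the extents of all $F$-tunnels. Theorem. Let $(\mathfrak A,\mathsf L_{\mathfrak A})$ and $(\mathfrak B,\mathsf L_{\mathfrak B})$ be quantum compact metric spaces, with $\mathsf L_{\mathfrak B}$ $F$-Leibniz. Let $\alpha:\mathfrak A\to\mathfrak B$ be a unital *-monomorphism and let $\mathbb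 E$ be a conditional expectation of $\mathfrak B$ onto $\alpha(\mathfrak A)$, such that for some $m_\alpha>0$: - $m_\alpha\mathsf L_{\mathfrak A}(a)\le\mathsf L_{\mathfrak B}(\alpha(a))\le\mathsf L_{\mathfrak A}(a)$ for all $a\in\mathfrak{sa}(\mathfrak A)$, - $\mathsf L_{\mathfrak B}(\mathbb E(b))\le\mathsf L_{\mathfrak B}(b)$ for all $b\in\mathfrak{sa}(\mathfrak B)$. Let $\varepsilon>0$ and, for all $b\in\mathfrak{sa}(\mathfrak B)$, set $$\mathsf L^\varepsilon_{\mathfrak B}(b)=\max\left\{\mathsf L_{\mathfrak B}(b),\ \tfrac1\varepsilon\|b-\mathbb E(b)\|_{\mathfrak B},\ \mathsf L_{\mathfrak A}(\alpha^{-1}(\mathbb E(b)))\right\}.$$ Let $G=\max\left\{\max\{1,\tfrac1{m_\alpha}\}\cdot F,\ F_{2,0}\right\}$, where $F_{2,0}(x,y,l,l')=2(xl'+yl)$. Then $(\mathfrak A,\mathsf L_{\mathfrak A})$ and $(\mathfrak B,\mathsf L^\varepsilon_{\mathfrak B})$ are $G$-Leibniz quantum compact metric spaces, and $$\mathsf\Lambda^*_G\big((\mathfrak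 A,\mathsf L_{\mathfrak A}),(\mathfrak B,\mathsf L^\varepsilon_{\mathfrak B})\big)\le\varepsilon.$$ In particular one may take $G=\max\{1,\tfrac1{m_\alpha}\}\cdot F$ when $\max\{1,\tfrac1{m_\alpha}\}\cdot F\ge F_{2,0}$. -/

import Mathlib

namespace QuantumMetric

open scoped NNReal ENNReal Topology

universe u v w

/-! ### States and conditional expectations -/

section States

open scoped ComplexOrder

/-- The state space of a unital C*-algebra: the positive linear functionals mapping `1` to `1`,
with the weak* topology. -/
def stateSpace (A : Type u) [CStarAlgebra A] : Set (WeakDual ℂ A) :=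
  {φ | φ 1 = 1 ∧ ∀ a : A, 0 ≤ φ (star a * a)}

end States

/-- The self-adjoint element `f a`, for `f` a unital *-morphism and `a` self-adjoint. -/
def saMap {A : Type u} {B : Type v} [CStarAlgebra A] [CStarAlgebra B]
    (f : A →⋆ₐ[ℂ] B) (a : selfAdjoint A) : selfAdjoint B :=
  ⟨f a, by
    have h : star (a : A) = a := a.2
    rw [selfAdjoint.mem_iff, ← map_star, h]⟩

/-- A conditional expectation of `B` onto the unital *-subalgebra `C`: a positive contractive
linear projection of `B` onto `C` which is a `C`-bimodule map. -/
structure CondExp {B : Type v} [CStarAlgebra B] (C : StarSubalgebra ℂ B) where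
  /-- The underlying linear map. -/
  toLinearMap : B →ₗ[ℂ] C
  apply_coe : ∀ c : C, toLinearMap c = c
  norm_le : ∀ b : B, ‖(toLinearMap b : B)‖ ≤ ‖b‖
  positive : ∀ b : B, ∃ d : B, (toLinearMap (star b * b) : B) = star d * d
  bimodule : ∀ (c d : C) (b : B), toLinearMap (c * b * d) = c * toLinearMap b * d

/-- A conditional expectation maps self-adjoint elements to self-adjoint elements. -/
theorem CondExp.star_apply {B : Type v} [CStarAlgebra B] {C : StarSubalgebra ℂ B} (E : CondExp C)
    (b : selfAdjoint B) : star (E.toLinearMap b) = E.toLinearMap b := by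
  have hb : star (b : B) = b := b.2
  have key : (4 : ℂ) • (b : B)
      = star ((b : B) + 1) * (b + 1) - star ((b : B) - 1) * (b - 1) := by
    rw [star_add, star_sub, hb, star_one,
      show (4 : ℂ) • (b : B) = b + b + b + b by
        rw [show (4 : ℂ) = 1 + 1 + 1 + 1 by norm_num]; simp only [add_smul, one_smul]]
    noncomm_ring
  obtain ⟨p, hp⟩ := E.positive ((b : B) + 1)
  obtain ⟨q, hq⟩ := E.positive ((b : B) - 1)
  have h1 : (4 : ℂ) • (E.toLinearMap b : B) = star p * p - star q * q := by
    rw [← hp, ← hq, ← AddSubgroupClass.coe_sub, ← map_sub, ← key, map_smul]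
    rfl
  have h2 : (E.toLinearMap b : B) = (4 : ℂ)⁻¹ • (star p * p - star q * q) := by
    rw [← h1, smul_smul]; norm_num
  apply Subtype.ext
  change star (E.toLinearMap b : B) = E.toLinearMap b
  rw [h2, star_smul]
  simp

/-- The self-adjoint element `E b`, for `b` self-adjoint. -/
noncomputable def CondExp.onSA {B : Type v} [CStarAlgebra B] {C : StarSubalgebra ℂ B} (E : CondExp C)
    (b : selfAdjoint B) : selfAdjoint B :=
  ⟨E.toLinearMap b, congrArg Subtype.val (E.star_apply b)⟩

/-! ### Lip-norms

A seminorm defined on a subspace of `selfAdjoint A` is encoded, as usual, by its extension with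
the value `∞` off its domain. -/

/-- `L` is a seminorm on the real subspace `{a | L a ≠ ∞}` (with `0 * ∞ = 0`, the condition
`map_smul` gives `L 0 = 0`). -/
structure IsExtSeminorm {A : Type u} [CStarAlgebra A] (L : selfAdjoint A → ℝ≥0∞) : Prop where
  add_le : ∀ a b, L (a + b) ≤ L a + L b
  map_smul : ∀ (t : ℝ) (a), L (t • a) = ‖t‖₊ * L a

/-- The Monge-Kantorovich metric of `L`:
`sup {|φ a - ψ a| : a self-adjoint, L a ≤ 1}`. -/
noncomputable def mkMetric {A : Type u} [CStarAlgebra A] (L : selfAdjoint A → ℝ≥0∞)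
    (φ ψ : stateSpace A) : ℝ≥0∞ :=
  ⨆ (a : selfAdjoint A) (_ : L a ≤ 1), edist (φ.1 (a : A)) (ψ.1 (a : A))

/-- `L` is a Lip-norm on the unital C*-algebra `A`, i.e. `(selfAdjoint A, L)` is a quantum metric
order unit space. -/
structure IsLipNorm {A : Type u} [CStarAlgebra A] (L : selfAdjoint A → ℝ≥0∞) : Prop where
  seminorm : IsExtSeminorm L
  dense_domain : Dense {a | L a ≠ ∞}
  eq_zero_iff : ∀ a, L a = 0 ↔ ∃ t : ℝ, a = t • (1 : selfAdjoint A)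
  /- The Monge-Kantorovich metric is finite and induces the weak* topology. -/
  mk_ne_top : ∀ φ ψ : stateSpace A, mkMetric L φ ψ ≠ ∞
  mk_metrizes : ∀ φ : stateSpace A,
    (𝓝 φ).HasBasis (fun r : ℝ≥0∞ => 0 < r) (fun r => {ψ | mkMetric L φ ψ < r})
  isClosed_ball : IsClosed {a | L a ≤ 1}

/-- `(A, L)` is a quantum compact metric space with the `F`-Leibniz property, where
`F (x, y, l, l')` is increasing. For self-adjoint `a` and `b`, the real and imaginary parts
of `a * b` are `(a * b + b * a) / 2` and `(a * b - b * a) / (2 * i)`. -/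
structure IsLeibnizQCMS {A : Type u} [CStarAlgebra A] (F : ℝ≥0 × ℝ≥0 × ℝ≥0 × ℝ≥0 → ℝ≥0)
    (L : selfAdjoint A → ℝ≥0∞) : Prop where
  monotone : Monotone F
  isLipNorm : IsLipNorm L
  leibniz : ∀ a b : selfAdjoint A, L a ≠ ∞ → L b ≠ ∞ →
    max (L (realPart ((a : A) * b))) (L (imaginaryPart ((a : A) * b))) ≤
      F (‖a‖₊, ‖b‖₊, (L a).toNNReal, (L b).toNNReal)

/-! ### The propinquity -/

/-- The Hausdorff distance between the sets `S` and `T`, for the (extended) metric `d`. -/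
noncomputable def hausdorff {X : Type u} (d : X → X → ℝ≥0∞) (S T : Set X) : ℝ≥0∞ :=
  max (⨆ x ∈ S, ⨅ y ∈ T, d x y) (⨆ y ∈ T, ⨅ x ∈ S, d x y)

/-- The *-morphism `π` is a quantum isometry from `(D, LD)` onto `(A, LA)`: it is surjective and
`LA` is the quotient seminorm of `LD` by `π`. -/
structure IsQuantumIsometry {D : Type w} {A : Type u} [CStarAlgebra D] [CStarAlgebra A]
    (LD : selfAdjoint D → ℝ≥0∞) (LA : selfAdjoint A → ℝ≥0∞) (π : D →⋆ₐ[ℂ] A) : Prop where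
  surjective : Function.Surjective π
  quotient : ∀ a : selfAdjoint A, LA a = ⨅ (d : selfAdjoint D) (_ : saMap π d = a), LD d

/-- The states of `D` of the form `φ ∘ π` with `φ` a state of `A`. -/
def pullbackStates {D : Type w} {A : Type u} [CStarAlgebra D] [CStarAlgebra A]
    (π : D →⋆ₐ[ℂ] A) : Set (stateSpace D) :=
  {ψ | ∃ φ : stateSpace A, ∀ d : D, ψ.1 d = φ.1 (π d)}

/-- An `F`-tunnel from `(A, LA)` to `(B, LB)`: an `F`-Leibniz quantum compact metric space `(D, L)`
with quantum isometries onto `(A, LA)` and `(B, LB)`. -/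
structure Tunnel {A : Type u} {B : Type v} [CStarAlgebra A] [CStarAlgebra B]
    (F : ℝ≥0 × ℝ≥0 × ℝ≥0 × ℝ≥0 → ℝ≥0)
    (LA : selfAdjoint A → ℝ≥0∞) (LB : selfAdjoint B → ℝ≥0∞) where
  D : Type (max u v)
  [cstar : CStarAlgebra D]
  L : selfAdjoint D → ℝ≥0∞
  isLeibniz : IsLeibnizQCMS F L
  πA : D →⋆ₐ[ℂ] A
  πB : D →⋆ₐ[ℂ] B
  isometryA : IsQuantumIsometry L LA πA
  isometryB : IsQuantumIsometry L LB πB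

attribute [instance] Tunnel.cstar

/-- The extent of a tunnel. -/
noncomputable def Tunnel.extent {A : Type u} {B : Type v} [CStarAlgebra A] [CStarAlgebra B]
    {F : ℝ≥0 × ℝ≥0 × ℝ≥0 × ℝ≥0 → ℝ≥0}
    {LA : selfAdjoint A → ℝ≥0∞} {LB : selfAdjoint B → ℝ≥0∞} (τ : Tunnel F LA LB) : ℝ≥0∞ :=
  max (hausdorff (mkMetric τ.L) Set.univ (pullbackStates τ.πA))
    (hausdorff (mkMetric τ.L) Set.univ (pullbackStates τ.πB))

/-- The propinquity on the class of `F`-Leibniz quantum compact metric spaces: the infimum of the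
extents of all `F`-tunnels (`∞` if there is none). -/
noncomputable def propinquity {A : Type u} {B : Type v} [CStarAlgebra A] [CStarAlgebra B]
    (F : ℝ≥0 × ℝ≥0 × ℝ≥0 × ℝ≥0 → ℝ≥0)
    (LA : selfAdjoint A → ℝ≥0∞) (LB : selfAdjoint B → ℝ≥0∞) : ℝ≥0∞ :=
  ⨅ τ : Tunnel F LA LB, τ.extent

/-! ### The modified seminorm -/

/-- `α⁻¹ ∘ E` on self-adjoint elements, for `E` a conditional expectation onto the range of the
injective *-morphism `α`. -/
noncomputable def pullExp {A : Type u} {B : Type v} [CStarAlgebra A] [CStarAlgebra B]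
    (α : A →⋆ₐ[ℂ] B) (hα : Function.Injective α) (E : CondExp α.range) (b : selfAdjoint B) :
    selfAdjoint A :=
  ⟨(StarAlgEquiv.ofInjective α hα).symm (E.toLinearMap b), by
    rw [selfAdjoint.mem_iff, ← map_star, E.star_apply]⟩

/-- `Lᵋ(b) = max {LB b, ‖b - E b‖ / ε, LA (α⁻¹ (E b))}`. -/
noncomputable def modifiedSeminorm {A : Type u} {B : Type v} [CStarAlgebra A] [CStarAlgebra B]
    (α : A →⋆ₐ[ℂ] B) (hα : Function.Injective α) (E : CondExp α.range)
    (LA : selfAdjoint A → ℝ≥0∞) (LB : selfAdjoint B → ℝ≥0∞) (ε : ℝ≥0) (b : selfAdjoint B) :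
    ℝ≥0∞ :=
  max (LB b) (max ((‖b - E.onSA b‖₊ / ε : ℝ≥0) : ℝ≥0∞)
    (LA (pullExp α hα E b)))

/-- `F₂₀(x, y, l, l') = 2 (x l' + y l)`. -/
def leibnizTwo : ℝ≥0 × ℝ≥0 × ℝ≥0 × ℝ≥0 → ℝ≥0 :=
  fun (x, y, l, l') => 2 * (x * l' + y * l)

/-- `G = max {max {1, 1 / m} F, F₂₀}`. -/
noncomputable def leibnizBound (m : ℝ≥0) (F : ℝ≥0 × ℝ≥0 × ℝ≥0 × ℝ≥0 → ℝ≥0) :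
    ℝ≥0 × ℝ≥0 × ℝ≥0 × ℝ≥0 → ℝ≥0 :=
  fun p => max (max 1 (1 / m) * F p) (leibnizTwo p)

end QuantumMetric

namespace QuantumMetric

open scoped NNReal ENNReal Topology ComplexOrder CStarAlgebra
open Filter

/-! ### States -/

section States

variable {A : Type*} {D : Type*} [CStarAlgebra A] [CStarAlgebra D]

/-! The tunnel is `A × B` with the seminorm max {LA a, ‖α a - b‖ / ε, Lᵋ b} and the two coordinate
projections. Write P = α⁻¹ ∘ E, a unital positive contraction that is a left inverse of α. An
element a lifts to (a, α a), and b lifts to (P b, b). Neither lift raises the seminorm: the first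
because Lᵋ (α a) = LA a, the second because Lᵋ is built to dominate ‖b - E b‖ / ε and LA (P b).
Hence both projections are quantum isometries (`isQuantumIsometry_fst`, `isQuantumIsometry_snd`).
Composing a state of `A × B` with either lift moves it by at most ε on the unit ball, where ‖α a -
b‖ ≤ ε; this bounds the extent.

Both Lip-norm proofs rest on `IsLipNorm.of_tendsto`: over a dense domain, Monge-Kantorovich
convergence always implies weak* convergence, so only finiteness and weak* continuity of the metric
are at stake. For Lᵋ they follow from Lᵋ ≥ LB. For the tunnel, `mkMetric_tunnelNorm_le` bounds the
metric by those of the two factors plus ε times the change in the weight ψ (1, 0).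

In the Leibniz bound G, the factor 1 / m pays for returning from LB to LA, and the 2 in F₂₀ is the
bound for the norm of id - E. -/

theorem exists_norm_smul_one_sub_eq {a : A} (ha : IsSelfAdjoint a) :
    ∃ d : A, (‖a‖ : ℂ) • (1 : A) - a = star d * d := by
  let _ := CStarAlgebra.spectralOrder A
  have := CStarAlgebra.spectralOrderedRing A
  have h : a ≤ algebraMap ℝ A ‖a‖ := ha.le_algebraMap_norm_self
  rw [← sub_nonneg, CStarAlgebra.nonneg_iff_eq_star_mul_self] at h
  simpa [Algebra.algebraMap_eq_smul_one] using! h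

/-- Positivity is applied to ‖a‖ - a and ‖a‖ + a. The self-adjoint case suffices, since Lip-norms
see only self-adjoint elements. -/
theorem state_norm_le (φ : stateSpace A) {a : A} (ha : IsSelfAdjoint a) : ‖φ.1 a‖ ≤ ‖a‖ := by
  have key : ∀ b : A, IsSelfAdjoint b → 0 ≤ (‖b‖ : ℂ) - φ.1 b := by
    intro b hb
    obtain ⟨d, hd⟩ := exists_norm_smul_one_sub_eq hb
    have := φ.2.2 d
    rwa [← hd, map_sub, map_smul, φ.2.1, smul_eq_mul, mul_one] at this
  have h1 := key a ha
  have h2 := key (-a) ha.neg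
  rw [norm_neg, map_neg, sub_neg_eq_add] at h2
  rw [Complex.nonneg_iff] at h1 h2
  simp only [Complex.sub_re, Complex.ofReal_re, Complex.add_re, Complex.add_im, Complex.ofReal_im,
    zero_add] at h1 h2
  -- The order on ℂ makes `0 ≤ z` include that `z` is real.
  have him : φ.1 a = ((φ.1 a).re : ℂ) := by
    apply Complex.ext <;> simp [← h2.2]
  rw [him, Complex.norm_real, Real.norm_eq_abs, abs_le]
  constructor <;> linarith [h1.1, h2.1]

/-- The state `φ ∘ P`, for `P` a unital positive map. -/
noncomputable def stateComp (P : A →L[ℂ] D) (h1 : P 1 = 1) (hpos : ∀ a, ∃ d, P (star a * a) = star d * d)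
    (φ : stateSpace D) : stateSpace A :=
  ⟨(WeakDual.toStrongDual φ.1).comp P, by
    refine ⟨?_, fun a => ?_⟩
    · change φ.1 (P 1) = 1
      rw [h1, φ.2.1]
    · obtain ⟨d, hd⟩ := hpos a
      change 0 ≤ φ.1 (P (star a * a))
      rw [hd]
      exact φ.2.2 d⟩

theorem continuous_stateComp (P : A →L[ℂ] D) (h1 : P 1 = 1)
    (hpos : ∀ a, ∃ d, P (star a * a) = star d * d) : Continuous (stateComp P h1 hpos) := by
  refine Continuous.subtype_mk (WeakDual.continuous_of_continuous_eval fun a => ?_) _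
  exact (WeakDual.eval_continuous (P a)).comp continuous_subtype_val

/-- Take for z the square root of the nonnegative number φ (a* a). This puts positivity of scalar
values in the form `stateComp` asks for. -/
theorem exists_state_star_mul_self (φ : stateSpace A) (a : A) :
    ∃ z : ℂ, φ.1 (star a * a) = star z * z := by
  have h := φ.2.2 a
  rw [Complex.nonneg_iff] at h
  refine ⟨(Real.sqrt (φ.1 (star a * a)).re : ℂ), ?_⟩
  rw [Complex.star_def, Complex.conj_ofReal, ← Complex.ofReal_mul, Real.mul_self_sqrt h.1]
  apply Complex.ext <;> simp [← h.2]

end States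

/-! ### Monge-Kantorovich metrics and Lip-norms -/

section LipNorm

variable {A : Type*} {D : Type*} [CStarAlgebra A] [CStarAlgebra D]

theorem edist_le_mkMetric {L : selfAdjoint A → ℝ≥0∞} (φ ψ : stateSpace A) {a : selfAdjoint A}
    (ha : L a ≤ 1) : edist (φ.1 (a : A)) (ψ.1 (a : A)) ≤ mkMetric L φ ψ :=
  le_iSup₂_of_le (f := fun (a : selfAdjoint A) (_ : L a ≤ 1) =>
    edist (φ.1 (a : A)) (ψ.1 (a : A))) a ha le_rfl

theorem mkMetric_self (L : selfAdjoint A → ℝ≥0∞) (φ : stateSpace A) : mkMetric L φ φ = 0 := by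
  simp [mkMetric]

theorem mkMetric_anti {L L' : selfAdjoint A → ℝ≥0∞} (h : ∀ a, L a ≤ L' a) (φ ψ : stateSpace A) :
    mkMetric L' φ ψ ≤ mkMetric L φ ψ :=
  iSup₂_le fun _ ha => edist_le_mkMetric φ ψ ((h _).trans ha)

theorem IsLipNorm.tendsto_mkMetric {L : selfAdjoint A → ℝ≥0∞} (h : IsLipNorm L)
    (φ : stateSpace A) : Tendsto (mkMetric L φ) (𝓝 φ) (𝓝 0) := by
  rw [ENNReal.tendsto_nhds_zero]
  intro r hr
  filter_upwards [(h.mk_metrizes φ).mem_of_mem hr] with ψ hψ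
  exact le_of_lt hψ

/-- Convergence for the Monge-Kantorovich metric implies pointwise convergence, on the domain. -/
theorem tendsto_apply_of_ne_top {L : selfAdjoint A → ℝ≥0∞} (hL : IsExtSeminorm L)
    (φ : stateSpace A) {a : selfAdjoint A} (ha : L a ≠ ∞) :
    Tendsto (fun ψ : stateSpace A => ψ.1 (a : A)) (comap (mkMetric L φ) (𝓝 0))
      (𝓝 (φ.1 (a : A))) := by
  -- Rescaling by 1 / c brings a into the unit ball; the added 1 keeps c positive when L a = 0.
  set c : ℝ := (L a).toReal + 1 with hc
  have hc0 : 0 < c := by positivity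
  have hLa : L (c⁻¹ • a) ≤ 1 := by
    rw [hL.map_smul, nnnorm_inv, ENNReal.coe_inv (by simpa using hc0.ne'), mul_comm,
      ← div_eq_mul_inv]
    refine ENNReal.div_le_of_le_mul ?_
    rw [one_mul, ← ENNReal.ofReal_toReal ha, ← enorm_eq_nnnorm, ← ofReal_norm, Real.norm_of_nonneg hc0.le]
    exact ENNReal.ofReal_le_ofReal (by linarith)
  have key : Tendsto (fun ψ : stateSpace A => ψ.1 ((c⁻¹ • a : selfAdjoint A) : A))
      (comap (mkMetric L φ) (𝓝 0)) (𝓝 (φ.1 ((c⁻¹ • a : selfAdjoint A) : A))) := by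
    rw [tendsto_iff_edist_tendsto_0]
    refine tendsto_of_tendsto_of_tendsto_of_le_of_le tendsto_const_nhds tendsto_comap
      (fun _ => zero_le) fun ψ => ?_
    rw [edist_comm]
    exact edist_le_mkMetric φ ψ hLa
  have hsm : ∀ ψ : stateSpace A, ψ.1 (a : A) = c * ψ.1 ((c⁻¹ • a : selfAdjoint A) : A) := by
    intro ψ
    have : ((c⁻¹ • a : selfAdjoint A) : A) = ((c⁻¹ : ℝ) : ℂ) • (a : A) := by
      rw [Complex.coe_smul]; rfl
    rw [this, map_smul, smul_eq_mul, ← mul_assoc, ← Complex.ofReal_mul, mul_inv_cancel₀ hc0.ne',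
      Complex.ofReal_one, one_mul]
  simp_rw [hsm]
  exact key.const_mul _

/-- States are contractive on self-adjoint elements, so convergence passes from the dense domain to
all of them by an r / 3 argument, then to all of the algebra through real and imaginary parts. -/
theorem comap_mkMetric_le_nhds {L : selfAdjoint A → ℝ≥0∞} (hL : IsExtSeminorm L)
    (hd : Dense {a | L a ≠ ∞}) (φ : stateSpace A) : comap (mkMetric L φ) (𝓝 0) ≤ 𝓝 φ := by
  have hsa : ∀ a : selfAdjoint A, Tendsto (fun ψ : stateSpace A => ψ.1 (a : A))
      (comap (mkMetric L φ) (𝓝 0)) (𝓝 (φ.1 (a : A))) := by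
    intro a
    rw [Metric.tendsto_nhds]
    intro r hr
    obtain ⟨b, hb, hab⟩ := Metric.dense_iff.1 hd a (r / 3) (by positivity)
    filter_upwards [Metric.tendsto_nhds.1 (tendsto_apply_of_ne_top hL φ hab) (r / 3)
      (by positivity)] with ψ hψ
    have hba : ∀ χ : stateSpace A, dist (χ.1 (a : A)) (χ.1 (b : A)) < r / 3 := by
      intro χ
      rw [dist_eq_norm, ← map_sub]
      refine (state_norm_le χ (a - b).2).trans_lt ?_
      rw [Metric.mem_ball', dist_eq_norm] at hb
      exact hb
    calc dist (ψ.1 (a : A)) (φ.1 (a : A))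
        ≤ dist (ψ.1 (a : A)) (ψ.1 (b : A)) + dist (ψ.1 (b : A)) (φ.1 (b : A))
          + dist (φ.1 (b : A)) (φ.1 (a : A)) := dist_triangle4 _ _ _ _
      _ < r := by
        rw [dist_comm (φ.1 (b : A))]
        linarith [hba ψ, hba φ]
  have : Tendsto (fun ψ : stateSpace A => ψ.1) (comap (mkMetric L φ) (𝓝 0)) (𝓝 φ.1) := by
    rw [tendsto_iff_forall_eval_tendsto_topDualPairing]
    intro a
    have hdec : ∀ χ : stateSpace A, χ.1 a
        = χ.1 (realPart a : A) + Complex.I * χ.1 (imaginaryPart a : A) := by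
      intro χ
      rw [← smul_eq_mul, ← map_smul, ← map_add, realPart_add_I_smul_imaginaryPart]
    have h2 := (hsa (realPart a)).add ((hsa (imaginaryPart a)).const_mul Complex.I)
    simp_rw [← hdec] at h2
    exact h2
  exact tendsto_subtype_rng.2 this

/-- A criterion for Lip-norms: given a dense domain, it suffices that the Monge-Kantorovich metric
be continuous for the weak* topology. -/
theorem IsLipNorm.of_tendsto {L : selfAdjoint A → ℝ≥0∞} (hL : IsExtSeminorm L)
    (hd : Dense {a | L a ≠ ∞}) (h0 : ∀ a, L a = 0 ↔ ∃ t : ℝ, a = t • (1 : selfAdjoint A))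
    (hfin : ∀ φ ψ : stateSpace A, mkMetric L φ ψ ≠ ∞)
    (hcont : ∀ φ : stateSpace A, Tendsto (mkMetric L φ) (𝓝 φ) (𝓝 0))
    (hcl : IsClosed {a | L a ≤ 1}) : IsLipNorm L where
  seminorm := hL
  dense_domain := hd
  eq_zero_iff := h0
  mk_ne_top := hfin
  mk_metrizes φ := by
    -- Only the inclusion given by continuity of the metric uses `hcont`; the other one is
    -- automatic.
    have h : 𝓝 φ = comap (mkMetric L φ) (𝓝 0) :=
      le_antisymm (tendsto_iff_comap.1 (hcont φ)) (comap_mkMetric_le_nhds hL hd φ)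
    rw [h]
    exact ENNReal.nhds_zero_basis.comap _
  isClosed_ball := hcl

end LipNorm

/-! ### Self-adjoint parts of linear maps and Leibniz inequalities -/

section SelfAdjoint

variable {A : Type*} {B : Type*} {D : Type*} [CStarAlgebra A] [CStarAlgebra B] [CStarAlgebra D]

/-- The restriction to self-adjoint elements of a continuous linear map preserving them. -/
noncomputable def saCLM (P : A →L[ℂ] D) (hP : ∀ a, IsSelfAdjoint a → IsSelfAdjoint (P a)) :
    selfAdjoint A →L[ℝ] selfAdjoint D where
  toFun a := ⟨P a, hP a a.2⟩
  map_add' a b := Subtype.ext (by simp)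
  map_smul' t a := Subtype.ext (by
    change P (t • (a : A)) = t • P (a : A)
    rw [← Complex.coe_smul, ← Complex.coe_smul, map_smul])
  cont := by fun_prop

/-- A unital *-morphism on self-adjoint elements, as a continuous linear map. -/
noncomputable def saMapCLM (f : A →⋆ₐ[ℂ] D) : selfAdjoint A →L[ℝ] selfAdjoint D :=
  saCLM ⟨f.toAlgHom.toLinearMap, map_continuous f⟩ fun _ ha => ha.map f

@[simp]
theorem saMapCLM_apply (f : A →⋆ₐ[ℂ] D) (a : selfAdjoint A) : saMapCLM f a = saMap f a := rfl

@[simp]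
theorem coe_saMap (f : A →⋆ₐ[ℂ] D) (a : selfAdjoint A) : (saMap f a : D) = f a := rfl

theorem saMap_realPart (f : A →⋆ₐ[ℂ] D) (x : A) :
    saMap f (realPart x) = realPart (f x) := by
  apply Subtype.ext
  rw [coe_saMap, realPart_apply_coe, realPart_apply_coe, ← Complex.coe_smul, ← Complex.coe_smul,
    map_smul, map_add, map_star]

theorem saMap_realPart_smul_mul (f : A →⋆ₐ[ℂ] D) (s : ℂ) (x y : A) :
    saMap f (realPart (s • (x * y))) = realPart (s • (f x * f y)) := by
  rw [saMap_realPart, map_smul, map_mul]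

theorem imaginaryPart_eq_realPart_smul (x : A) :
    imaginaryPart x = realPart (-Complex.I • x) := by
  simp

/-- Bounds on the real and imaginary parts of `x` are bounds on the real parts of `s • x`, for
`s = 1` and `s = -i`. -/
theorem max_realPart_imaginaryPart_le_iff {L : selfAdjoint A → ℝ≥0∞} {x : A} {K : ℝ≥0∞} :
    max (L (realPart x)) (L (imaginaryPart x)) ≤ K ↔
      ∀ s : ℂ, s = 1 ∨ s = -Complex.I → L (realPart (s • x)) ≤ K := by
  rw [imaginaryPart_eq_realPart_smul, max_le_iff]
  constructor
  · rintro ⟨h1, h2⟩ s (rfl | rfl)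
    · rwa [one_smul]
    · exact h2
  · intro h
    exact ⟨by simpa only [one_smul] using h 1 (Or.inl rfl), h _ (Or.inr rfl)⟩

theorem norm_realPart_smul_le {s : ℂ} (hs : s = 1 ∨ s = -Complex.I) (x : A) :
    ‖realPart (s • x)‖ ≤ ‖x‖ := by
  refine (realPart.norm_le _).trans ?_
  rcases hs with rfl | rfl <;> simp [norm_smul]

/-- The maximum of two seminorms and a scaled norm, pulled back by continuous linear maps. -/
theorem IsExtSeminorm.max_norm {LA : selfAdjoint A → ℝ≥0∞} {LB : selfAdjoint B → ℝ≥0∞}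
    (hA : IsExtSeminorm LA) (hB : IsExtSeminorm LB) {V : Type*} [SeminormedAddCommGroup V]
    [NormedSpace ℝ V] (f : selfAdjoint D →L[ℝ] selfAdjoint A) (g : selfAdjoint D →L[ℝ] V)
    (h : selfAdjoint D →L[ℝ] selfAdjoint B) (ε : ℝ≥0) :
    IsExtSeminorm fun d => max (LA (f d)) (max ((‖g d‖₊ / ε : ℝ≥0) : ℝ≥0∞) (LB (h d))) where
  add_le a b := by
    simp only [map_add]
    refine max_le ?_ (max_le ?_ ?_)
    · exact (hA.add_le _ _).trans (add_le_add (le_max_left _ _) (le_max_left _ _))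
    · refine le_trans ?_ (add_le_add ((le_max_left _ _).trans (le_max_right _ _))
        ((le_max_left _ _).trans (le_max_right _ _)))
      rw [← ENNReal.coe_add, ENNReal.coe_le_coe, ← add_div]
      exact div_le_div_of_nonneg_right (nnnorm_add_le _ _) zero_le
    · exact (hB.add_le _ _).trans (add_le_add ((le_max_right _ _).trans (le_max_right _ _))
        ((le_max_right _ _).trans (le_max_right _ _)))
  map_smul t a := by
    have hn : ((‖t • g a‖₊ / ε : ℝ≥0) : ℝ≥0∞) = ‖t‖₊ * ((‖g a‖₊ / ε : ℝ≥0) : ℝ≥0∞) := by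
      rw [nnnorm_smul, mul_div_assoc, ENNReal.coe_mul]
    simp only [_root_.map_smul, hA.map_smul, hB.map_smul, hn]
    rw [mul_max, mul_max]

theorem isClosed_ball_max_norm {LA : selfAdjoint A → ℝ≥0∞} {LB : selfAdjoint B → ℝ≥0∞}
    (hA : IsClosed {a | LA a ≤ 1}) (hB : IsClosed {b | LB b ≤ 1})
    {V : Type*} [SeminormedAddCommGroup V] [NormedSpace ℝ V]
    (f : selfAdjoint D →L[ℝ] selfAdjoint A) (g : selfAdjoint D →L[ℝ] V)
    (h : selfAdjoint D →L[ℝ] selfAdjoint B) (ε : ℝ≥0) :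
    IsClosed {d | max (LA (f d)) (max ((‖g d‖₊ / ε : ℝ≥0) : ℝ≥0∞) (LB (h d))) ≤ 1} := by
  simp only [max_le_iff, Set.ofPred_and]
  refine (hA.preimage f.continuous).inter (IsClosed.inter ?_ (hB.preimage h.continuous))
  refine isClosed_le (ENNReal.continuous_coe.comp ?_) continuous_const
  exact (g.continuous.nnnorm).div_const ε

theorem le_leibnizBound_left {m : ℝ≥0} {F : ℝ≥0 × ℝ≥0 × ℝ≥0 × ℝ≥0 → ℝ≥0} {p} :
    F p ≤ leibnizBound m F p :=
  (le_mul_of_one_le_left zero_le (le_max_left _ _)).trans (le_max_left _ _)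

/-- This is where the factor 1 / m of G is spent. Since m > 0, the finite bound also excludes x = ∞.
-/
theorem le_leibnizBound_of_mul_le {m : ℝ≥0} (hm : 0 < m) {F : ℝ≥0 × ℝ≥0 × ℝ≥0 × ℝ≥0 → ℝ≥0}
    {p} {x : ℝ≥0∞} (h : m * x ≤ F p) : x ≤ leibnizBound m F p := by
  have hx : x ≠ ∞ := by
    rintro rfl
    rw [ENNReal.mul_top (by exact_mod_cast hm.ne')] at h
    exact ENNReal.coe_ne_top (top_le_iff.1 h)
  lift x to ℝ≥0 using hx
  rw [← ENNReal.coe_mul, ENNReal.coe_le_coe] at h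
  rw [ENNReal.coe_le_coe]
  calc x = 1 / m * (m * x) := by field_simp
    _ ≤ 1 / m * F p := by gcongr
    _ ≤ max 1 (1 / m) * F p := by gcongr; exact le_max_right _ _
    _ ≤ _ := le_max_left _ _

theorem leibnizTwo_mono : Monotone leibnizTwo := by
  rintro ⟨x, y, l, l'⟩ ⟨x', y', k, k'⟩ ⟨h1, h2, h3, h4⟩
  dsimp only at h1 h2 h3 h4
  simp only [leibnizTwo]
  gcongr

theorem leibnizBound_mono (m : ℝ≥0) {F : ℝ≥0 × ℝ≥0 × ℝ≥0 × ℝ≥0 → ℝ≥0} (hF : Monotone F) :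
    Monotone (leibnizBound m F) := fun _ _ h =>
  max_le_max (mul_le_mul_of_nonneg_left (hF h) zero_le) (leibnizTwo_mono h)

theorem nnnorm_le_of_div_le {V : Type*} [SeminormedAddCommGroup V] {v : V} {ε : ℝ≥0} (hε : 0 < ε)
    {l : ℝ≥0∞} (hl : l ≠ ∞) (h : ((‖v‖₊ / ε : ℝ≥0) : ℝ≥0∞) ≤ l) : ‖v‖₊ ≤ ε * l.toNNReal := by
  lift l to ℝ≥0 using hl
  rwa [ENNReal.coe_le_coe, div_le_iff₀' hε] at h

theorem div_le_coe_of_nnnorm_le {V : Type*} [SeminormedAddCommGroup V] {v : V} {ε : ℝ≥0}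
    (hε : 0 < ε) {l : ℝ≥0} (h : ‖v‖₊ ≤ ε * l) : ((‖v‖₊ / ε : ℝ≥0) : ℝ≥0∞) ≤ l := by
  rwa [ENNReal.coe_le_coe, div_le_iff₀' hε]

end SelfAdjoint

/-! ### The expectation as a unital positive map onto the smaller algebra -/

section Expectation

variable {A : Type*} {B : Type*} [CStarAlgebra A] [CStarAlgebra B]
  (α : A →⋆ₐ[ℂ] B) (hα : Function.Injective α) (E : CondExp α.range)

/-- The map `α⁻¹ ∘ E`. -/
noncomputable def pullCLM : B →L[ℂ] A :=
  LinearMap.mkContinuous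
    ((StarAlgEquiv.ofInjective α hα).symm.toAlgEquiv.toLinearMap ∘ₗ E.toLinearMap) 1 fun b => by
      rw [one_mul, ← NonUnitalStarAlgHom.norm_map α hα]
      refine le_trans (le_of_eq ?_) (E.norm_le b)
      exact congrArg (fun x : α.range => ‖(x : B)‖)
        ((StarAlgEquiv.ofInjective α hα).apply_symm_apply (E.toLinearMap b))

theorem map_pullCLM (b : B) : α (pullCLM α hα E b) = E.toLinearMap b :=
  congrArg Subtype.val ((StarAlgEquiv.ofInjective α hα).apply_symm_apply (E.toLinearMap b))

theorem pullCLM_map (a : A) : pullCLM α hα E (α a) = a := by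
  apply hα
  rw [map_pullCLM]
  exact congrArg Subtype.val (E.apply_coe ⟨α a, a, rfl⟩)

theorem pullCLM_one : pullCLM α hα E 1 = 1 := by
  simpa using pullCLM_map α hα E 1

theorem norm_pullCLM_le (b : B) : ‖pullCLM α hα E b‖ ≤ ‖b‖ := by
  rw [← NonUnitalStarAlgHom.norm_map α hα, map_pullCLM]
  exact E.norm_le b

theorem saMap_pullExp (b : selfAdjoint B) : saMap α (pullExp α hα E b) = E.onSA b :=
  Subtype.ext (map_pullCLM α hα E b)

theorem pullExp_saMap (a : selfAdjoint A) : pullExp α hα E (saMap α a) = a :=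
  Subtype.ext (pullCLM_map α hα E a)

theorem onSA_saMap (a : selfAdjoint A) : E.onSA (saMap α a) = saMap α a := by
  have h : (E.toLinearMap (α a) : B) = α a := congrArg Subtype.val (E.apply_coe ⟨α a, a, rfl⟩)
  exact Subtype.ext h

/-- The map `α⁻¹ ∘ E` on self-adjoint elements, as a continuous linear map. -/
noncomputable def pullExpCLM : selfAdjoint B →L[ℝ] selfAdjoint A :=
  saCLM (pullCLM α hα E) fun b hb => (pullExp α hα E ⟨b, hb⟩).2

@[simp]
theorem pullExpCLM_apply (b : selfAdjoint B) : pullExpCLM α hα E b = pullExp α hα E b := rfl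

/-- Injective unital *-morphisms reflect positivity. -/
theorem exists_eq_star_mul_self_of_map {α : A →⋆ₐ[ℂ] B}
    (hα : Function.Injective α) {a : A} {d : B} (h : α a = star d * d) :
    ∃ c, a = star c * c := by
  let _ := CStarAlgebra.spectralOrder A
  have := CStarAlgebra.spectralOrderedRing A
  let _ := CStarAlgebra.spectralOrder B
  have := CStarAlgebra.spectralOrderedRing B
  have hn : ∀ x : A, ‖α x‖ = ‖x‖ := NonUnitalStarAlgHom.norm_map α hα
  have ha : IsSelfAdjoint a := by
    apply hα
    rw [map_star, h, star_mul, star_star]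
  rw [← CStarAlgebra.nonneg_iff_eq_star_mul_self, nonneg_iff_isSelfAdjoint_and_quasispectrumRestricts]
  have hb := (nonneg_iff_isSelfAdjoint_and_quasispectrumRestricts.1 (h ▸ star_mul_self_nonneg d :
    0 ≤ α a)).2
  -- A self-adjoint x is positive exactly when ‖t - x‖ ≤ t for some t ≥ ‖x‖. With t = ‖a‖ this is a
  -- condition on norms alone, and α preserves norms.
  replace hb := (SpectrumRestricts.nnreal_iff_nnnorm (ha.map α) (t := ‖a‖₊) (hn a).le).1 hb
  refine ⟨ha, (SpectrumRestricts.nnreal_iff_nnnorm ha le_rfl).2 ?_⟩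
  have h2 : α (algebraMap ℝ A (‖a‖₊ : ℝ) - a) = algebraMap ℝ B (‖a‖₊ : ℝ) - α a := by
    rw [map_sub, IsScalarTower.algebraMap_apply ℝ ℂ A, IsScalarTower.algebraMap_apply ℝ ℂ B,
      AlgHomClass.commutes]
  rw [← NNReal.coe_le_coe] at hb ⊢
  simp only [coe_nnnorm] at hb h2 ⊢
  rwa [← hn, h2]

theorem pullCLM_pos (b : B) : ∃ d, pullCLM α hα E (star b * b) = star d * d := by
  obtain ⟨d, hd⟩ := E.positive b
  exact exists_eq_star_mul_self_of_map hα ((map_pullCLM α hα E _).trans hd)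

/-- The map id - E kills the range of α and has norm at most 2, so any approximant from the range
may be subtracted first. -/
theorem norm_sub_onSA_le (b : selfAdjoint B) (a : selfAdjoint A) :
    ‖b - E.onSA b‖ ≤ 2 * ‖b - saMap α a‖ := by
  have h : b - E.onSA b = (b - saMap α a) - E.onSA (b - saMap α a) := by
    apply Subtype.ext
    have h1 : (E.toLinearMap (α a) : B) = α a := congrArg Subtype.val (onSA_saMap α E a)
    change (b : B) - E.toLinearMap b = (b - α a) - (E.toLinearMap ((b : B) - α a) : B)
    rw [map_sub, AddSubgroupClass.coe_sub, h1]
    abel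
  rw [h, two_mul]
  exact (norm_sub_le _ _).trans (add_le_add le_rfl (E.norm_le _))

end Expectation

/-! ### The modified seminorm is a Leibniz Lip-norm -/

section Modified

variable {A : Type*} {B : Type*} [CStarAlgebra A] [CStarAlgebra B]
  {F : ℝ≥0 × ℝ≥0 × ℝ≥0 × ℝ≥0 → ℝ≥0}
  {LA : selfAdjoint A → ℝ≥0∞} {LB : selfAdjoint B → ℝ≥0∞}
  {α : A →⋆ₐ[ℂ] B} (hα : Function.Injective α) (E : CondExp α.range) {m ε : ℝ≥0}

theorem le_modifiedSeminorm (b : selfAdjoint B) :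
    LB b ≤ modifiedSeminorm α hα E LA LB ε b := le_max_left _ _

theorem norm_div_le_modifiedSeminorm (b : selfAdjoint B) :
    ((‖b - E.onSA b‖₊ / ε : ℝ≥0) : ℝ≥0∞) ≤ modifiedSeminorm α hα E LA LB ε b :=
  (le_max_left _ _).trans (le_max_right _ _)

theorem pullExp_le_modifiedSeminorm (b : selfAdjoint B) :
    LA (pullExp α hα E b) ≤ modifiedSeminorm α hα E LA LB ε b :=
  (le_max_right _ _).trans (le_max_right _ _)

theorem modifiedSeminorm_eq :
    modifiedSeminorm α hα E LA LB ε = fun b => max (LB (ContinuousLinearMap.id ℝ (selfAdjoint B) b))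
      (max ((‖(ContinuousLinearMap.id ℝ (selfAdjoint B) -
        (saMapCLM α).comp (pullExpCLM α hα E)) b‖₊ / ε : ℝ≥0) : ℝ≥0∞) (LA (pullExpCLM α hα E b))) := by
  funext b
  simp only [sub_apply, ContinuousLinearMap.comp_apply, pullExpCLM_apply,
    saMapCLM_apply, saMap_pullExp]
  rfl

theorem modifiedSeminorm_saMap (hα_upper : ∀ a, LB (saMap α a) ≤ LA a) (a : selfAdjoint A) :
    modifiedSeminorm α hα E LA LB ε (saMap α a) = LA a := by
  simp [modifiedSeminorm, onSA_saMap, pullExp_saMap, hα_upper a]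

theorem mul_pullExp_le (hα_lower : ∀ a, m * LA a ≤ LB (saMap α a))
    (hE : ∀ b, LB (E.onSA b) ≤ LB b) (b : selfAdjoint B) : m * LA (pullExp α hα E b) ≤ LB b := by
  refine (hα_lower _).trans ?_
  rw [saMap_pullExp]
  exact hE b

theorem modifiedSeminorm_ne_top (hm : 0 < m) (hα_lower : ∀ a, m * LA a ≤ LB (saMap α a))
    (hE : ∀ b, LB (E.onSA b) ≤ LB b) {b : selfAdjoint B} (hb : LB b ≠ ∞) :
    modifiedSeminorm α hα E LA LB ε b ≠ ∞ := by
  have h : LA (pullExp α hα E b) ≠ ∞ := by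
    intro h
    have := mul_pullExp_le hα E hα_lower hE b
    rw [h, ENNReal.mul_top (by exact_mod_cast hm.ne')] at this
    exact hb (top_le_iff.1 this)
  simp [modifiedSeminorm, hb, h]

/-- Since Lᵋ ≥ LB, its metric is the smaller one and inherits finiteness and weak* continuity. The
lower bound by m keeps Lᵋ finite wherever LB is, so the domain stays dense. -/
theorem isLipNorm_modifiedSeminorm (hLA : IsLipNorm LA) (hLB : IsLipNorm LB) (hm : 0 < m)
    (hα_lower : ∀ a, m * LA a ≤ LB (saMap α a)) (hα_upper : ∀ a, LB (saMap α a) ≤ LA a)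
    (hE : ∀ b, LB (E.onSA b) ≤ LB b) : IsLipNorm (modifiedSeminorm α hα E LA LB ε) := by
  have hle := le_modifiedSeminorm (LA := LA) (LB := LB) (ε := ε) hα E
  refine IsLipNorm.of_tendsto ?_ ?_ (fun b => ⟨fun h => ?_, ?_⟩) (fun φ ψ => ?_) (fun φ => ?_) ?_
  · rw [modifiedSeminorm_eq]
    exact hLB.seminorm.max_norm hLA.seminorm _ _ _ ε
  · exact hLB.dense_domain.mono fun b hb => modifiedSeminorm_ne_top hα E hm hα_lower hE hb
  · exact (hLB.eq_zero_iff b).1 (le_zero_iff.1 ((hle b).trans h.le))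
  · rintro ⟨t, rfl⟩
    have h1 : t • (1 : selfAdjoint B) = saMap α (t • 1) := by
      rw [← saMapCLM_apply, _root_.map_smul, saMapCLM_apply]
      congr 1
      exact Subtype.ext (map_one α).symm
    rw [h1, modifiedSeminorm_saMap hα E hα_upper]
    exact (hLA.eq_zero_iff _).2 ⟨t, rfl⟩
  · exact ((mkMetric_anti hle φ ψ).trans_lt (hLB.mk_ne_top φ ψ).lt_top).ne
  · exact tendsto_of_tendsto_of_tendsto_of_le_of_le tendsto_const_nhds (hLB.tendsto_mkMetric φ)
      (fun _ => zero_le) fun ψ => mkMetric_anti hle φ ψ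
  · rw [modifiedSeminorm_eq]
    exact isClosed_ball_max_norm hLB.isClosed_ball hLA.isClosed_ball _ _ _ ε

/-- The inequality for LB is pulled back along the isometric α: the upper bound enters inside F, the
lower bound costs 1 / m outside. -/
theorem leibniz_of_bilipschitz (hα : Function.Injective α) (hLB : IsLeibnizQCMS F LB) (hLA : IsLipNorm LA) (hm : 0 < m)
    (hα_lower : ∀ a, m * LA a ≤ LB (saMap α a)) (hα_upper : ∀ a, LB (saMap α a) ≤ LA a) :
    IsLeibnizQCMS (leibnizBound m F) LA where
  monotone := leibnizBound_mono m hLB.monotone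
  isLipNorm := hLA
  leibniz a b ha hb := by
    rw [max_realPart_imaginaryPart_le_iff]
    intro s hs
    have ha' : LB (saMap α a) ≠ ∞ := ((hα_upper a).trans_lt ha.lt_top).ne
    have hb' : LB (saMap α b) ≠ ∞ := ((hα_upper b).trans_lt hb.lt_top).ne
    refine le_leibnizBound_of_mul_le hm ((hα_lower _).trans ?_)
    have h := max_realPart_imaginaryPart_le_iff.1 (hLB.leibniz _ _ ha' hb') s hs
    have hn : ∀ c : selfAdjoint A, ‖saMap α c‖₊ = ‖c‖₊ := fun c =>
      NonUnitalStarAlgHom.nnnorm_map α hα (c : A)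
    rw [saMap_realPart_smul_mul]
    refine h.trans (ENNReal.coe_le_coe.2 (hLB.monotone ?_))
    rw [hn, hn]
    exact ⟨le_rfl, le_rfl, ENNReal.toNNReal_mono ha (hα_upper a),
      ENNReal.toNNReal_mono hb (hα_upper b)⟩

theorem isLeibniz_modifiedSeminorm (hLA : IsLipNorm LA) (hLB : IsLeibnizQCMS F LB) (hm : 0 < m)
    (hα_lower : ∀ a, m * LA a ≤ LB (saMap α a)) (hα_upper : ∀ a, LB (saMap α a) ≤ LA a)
    (hE : ∀ b, LB (E.onSA b) ≤ LB b) (hε : 0 < ε) :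
    IsLeibnizQCMS (leibnizBound m F) (modifiedSeminorm α hα E LA LB ε) where
  monotone := leibnizBound_mono m hLB.monotone
  isLipNorm := isLipNorm_modifiedSeminorm hα E hLA hLB.isLipNorm hm hα_lower hα_upper hE
  leibniz a b ha hb := by
    rw [max_realPart_imaginaryPart_le_iff]
    intro s hs
    set c := realPart (s • ((a : B) * b)) with hc
    have hle := le_modifiedSeminorm (LA := LA) (LB := LB) (ε := ε) hα E
    have ha' : LB a ≠ ∞ := ((hle a).trans_lt ha.lt_top).ne
    have hb' : LB b ≠ ∞ := ((hle b).trans_lt hb.lt_top).ne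
    have hF : LB c ≤ F (‖a‖₊, ‖b‖₊, (modifiedSeminorm α hα E LA LB ε a).toNNReal,
        (modifiedSeminorm α hα E LA LB ε b).toNNReal) :=
      (max_realPart_imaginaryPart_le_iff.1 (hLB.leibniz a b ha' hb') s hs).trans
        (ENNReal.coe_le_coe.2 (hLB.monotone ⟨le_rfl, le_rfl, ENNReal.toNNReal_mono ha (hle a),
          ENNReal.toNNReal_mono hb (hle b)⟩))
    refine max_le (hF.trans (ENNReal.coe_le_coe.2 le_leibnizBound_left)) (max_le ?_ ?_)
    · refine (div_le_coe_of_nnnorm_le hε ?_).trans (ENNReal.coe_le_coe.2 (le_max_right _ _))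
      have hA := nnnorm_le_of_div_le hε ha (norm_div_le_modifiedSeminorm hα E a)
      have hB := nnnorm_le_of_div_le hε hb (norm_div_le_modifiedSeminorm hα E b)
      set x := pullExp α hα E a with hx
      set y := pullExp α hα E b with hy
      rw [← saMap_pullExp α hα E, ← hx] at hA
      rw [← saMap_pullExp α hα E, ← hy] at hB
      -- The product of the expectations of a and b serves as the approximant of the product from
      -- the range of α.
      have h1 := norm_sub_onSA_le α E c (realPart (s • ((x : A) * y)))
      have h2 : c - saMap α (realPart (s • ((x : A) * y)))
          = realPart (s • ((a : B) * b - α x * α y)) := by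
        rw [saMap_realPart_smul_mul, hc, smul_sub, map_sub]
      have h3 : ‖(a : B) * b - α x * α y‖
          ≤ ‖a‖ * ‖b - saMap α y‖ + ‖a - saMap α x‖ * ‖b‖ := by
        -- This splitting leaves α y in the second term, where ‖α y‖ ≤ ‖b‖ because E is contractive.
        have h4 : (a : B) * b - α x * α y = a * (b - α y) + (a - α x) * α y := by noncomm_ring
        rw [h4]
        have hyb : ‖α y‖ ≤ ‖(b : B)‖ := by
          rw [NonUnitalStarAlgHom.norm_map α hα]
          exact norm_pullCLM_le α hα E b
        refine (norm_add_le _ _).trans (add_le_add (norm_mul_le _ _) ((norm_mul_le _ _).trans ?_))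
        exact mul_le_mul_of_nonneg_left hyb (norm_nonneg _)
      rw [h2] at h1
      have h5 := (norm_realPart_smul_le hs _).trans h3
      rw [← NNReal.coe_le_coe] at hA hB ⊢
      simp only [leibnizTwo, NNReal.coe_mul, NNReal.coe_add, coe_nnnorm, NNReal.coe_ofNat]
        at hA hB ⊢
      have h6 := mul_le_mul_of_nonneg_left hB (norm_nonneg a)
      have h7 := mul_le_mul_of_nonneg_right hA (norm_nonneg b)
      linarith
    · exact le_leibnizBound_of_mul_le hm ((mul_pullExp_le hα E hα_lower hE c).trans hF)

end Modified

/-! ### The tunnel on the direct sum -/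

section TunnelNorm

variable {A : Type*} {B : Type*} [CStarAlgebra A] [CStarAlgebra B]

/-- The seminorm `max {LA a, ‖α a - b‖ / ε, LB b}` at the pair `(a, b)`. -/
noncomputable def tunnelNorm (α : A →⋆ₐ[ℂ] B) (LA : selfAdjoint A → ℝ≥0∞)
    (LB : selfAdjoint B → ℝ≥0∞) (ε : ℝ≥0) (d : selfAdjoint (A × B)) : ℝ≥0∞ :=
  max (LA (saMap (StarAlgHom.fst ℂ A B) d))
    (max ((‖saMap α (saMap (StarAlgHom.fst ℂ A B) d) - saMap (StarAlgHom.snd ℂ A B) d‖₊ / ε :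
      ℝ≥0) : ℝ≥0∞) (LB (saMap (StarAlgHom.snd ℂ A B) d)))

/-- A pair of self-adjoint elements. -/
def pairSA (a : selfAdjoint A) (b : selfAdjoint B) : selfAdjoint (A × B) :=
  ⟨((a : A), (b : B)), Prod.ext a.2 b.2⟩

theorem tunnelNorm_pairSA (α : A →⋆ₐ[ℂ] B) (LA : selfAdjoint A → ℝ≥0∞)
    (LB : selfAdjoint B → ℝ≥0∞) (ε : ℝ≥0) (a : selfAdjoint A) (b : selfAdjoint B) :
    tunnelNorm α LA LB ε (pairSA a b)
      = max (LA a) (max ((‖saMap α a - b‖₊ / ε : ℝ≥0) : ℝ≥0∞) (LB b)) := rfl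

theorem exists_eq_pairSA (d : selfAdjoint (A × B)) : ∃ a b, d = pairSA a b :=
  ⟨saMap (StarAlgHom.fst ℂ A B) d, saMap (StarAlgHom.snd ℂ A B) d, rfl⟩

variable {α : A →⋆ₐ[ℂ] B} {LA : selfAdjoint A → ℝ≥0∞} {LB : selfAdjoint B → ℝ≥0∞} {ε : ℝ≥0}

theorem tunnelNorm_eq : tunnelNorm α LA LB ε = fun d =>
    max (LA (saMapCLM (StarAlgHom.fst ℂ A B) d))
    (max ((‖((saMapCLM α).comp (saMapCLM (StarAlgHom.fst ℂ A B)) -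
      saMapCLM (StarAlgHom.snd ℂ A B)) d‖₊ / ε : ℝ≥0) : ℝ≥0∞)
      (LB (saMapCLM (StarAlgHom.snd ℂ A B) d))) := rfl

theorem norm_sub_le_of_tunnelNorm_le_one (hε : 0 < ε) {a : selfAdjoint A} {b : selfAdjoint B}
    (h : tunnelNorm α LA LB ε (pairSA a b) ≤ 1) : ‖α a - b‖₊ ≤ ε := by
  have h1 := ((le_max_left _ _).trans (le_max_right _ _)).trans h
  have := nnnorm_le_of_div_le hε ENNReal.one_ne_top h1
  simpa using! this

theorem dense_tunnelNorm (hA : Dense {a | LA a ≠ ∞}) (hB : Dense {b | LB b ≠ ∞}) :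
    Dense {d | tunnelNorm α LA LB ε d ≠ ∞} := by
  rw [Metric.dense_iff]
  intro d r hr
  obtain ⟨a, b, rfl⟩ := exists_eq_pairSA d
  obtain ⟨a', ha, ha'⟩ := Metric.dense_iff.1 hA a r hr
  obtain ⟨b', hb, hb'⟩ := Metric.dense_iff.1 hB b r hr
  have hab : dist (pairSA a' b') (pairSA a b) = max (dist a' a) (dist b' b) := rfl
  refine ⟨pairSA a' b', Metric.mem_ball.2 (hab ▸ max_lt ha hb), ?_⟩
  change tunnelNorm α LA LB ε (pairSA a' b') ≠ ∞
  rw [tunnelNorm_pairSA]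
  exact (max_lt ha'.lt_top (max_lt ENNReal.coe_lt_top hb'.lt_top)).ne

/-- The unital positive map `a ↦ (a, μ a)`, for `μ` a state. -/
noncomputable def graphLeft (μ : stateSpace A) : A →L[ℂ] A × B :=
  (ContinuousLinearMap.id ℂ A).prod ((WeakDual.toStrongDual μ.1).smulRight (1 : B))

/-- The unital positive map `b ↦ (ν b, b)`, for `ν` a state. -/
noncomputable def graphRight (ν : stateSpace B) : B →L[ℂ] A × B :=
  ((WeakDual.toStrongDual ν.1).smulRight (1 : A)).prod (ContinuousLinearMap.id ℂ B)

theorem graphLeft_apply (μ : stateSpace A) (a : A) :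
    graphLeft (B := B) μ a = (a, μ.1 a • (1 : B)) := rfl

theorem graphRight_apply (ν : stateSpace B) (b : B) :
    graphRight (A := A) ν b = (ν.1 b • (1 : A), b) := rfl

/-- The state `a ↦ ψ (a, μ a)`. -/
noncomputable def stateLeft (μ : stateSpace A) : stateSpace (A × B) → stateSpace A :=
  stateComp (graphLeft μ) (by rw [graphLeft_apply, μ.2.1, one_smul]; rfl) fun a => by
    obtain ⟨z, hz⟩ := exists_state_star_mul_self μ a
    refine ⟨(a, z • (1 : B)), ?_⟩
    rw [graphLeft_apply, hz]
    simp [Prod.ext_iff, smul_smul, mul_comm]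

/-- The state `b ↦ ψ (ν b, b)`. -/
noncomputable def stateRight (ν : stateSpace B) : stateSpace (A × B) → stateSpace B :=
  stateComp (graphRight ν) (by rw [graphRight_apply, ν.2.1, one_smul]; rfl) fun b => by
    obtain ⟨z, hz⟩ := exists_state_star_mul_self ν b
    refine ⟨(z • (1 : A), b), ?_⟩
    rw [graphRight_apply, hz]
    simp [Prod.ext_iff, smul_smul, mul_comm]

/-- The restrictions of ψ to the two summands are positive but not normalized. Filling in the
missing mass with μ and ν makes them states; with t = ψ (1, 0), the correction is (1 - t) μ a + t ν
b. -/
theorem state_pair_eq (μ : stateSpace A) (ν : stateSpace B) (ψ : stateSpace (A × B))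
    (a : A) (b : B) : ψ.1 (a, b) = (stateLeft μ ψ).1 a + (stateRight ν ψ).1 b
      - (μ.1 a + ψ.1 (1, 0) * (ν.1 b - μ.1 a)) := by
  have h1 : (stateLeft μ ψ).1 a = ψ.1 (a, 0) + μ.1 a * (1 - ψ.1 (1, 0)) := by
    have h : ((a, μ.1 a • (1 : B)) : A × B) = (a, 0) + μ.1 a • (1 - (1, 0)) := by
      simp [Prod.ext_iff]
    change ψ.1 ((a, μ.1 a • (1 : B)) : A × B) = _
    rw [h, map_add, map_smul, map_sub, ψ.2.1, smul_eq_mul]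
  have h2 : (stateRight ν ψ).1 b = ψ.1 (0, b) + ν.1 b * ψ.1 (1, 0) := by
    have h : ((ν.1 b • (1 : A), b) : A × B) = (0, b) + ν.1 b • (1, 0) := by
      simp
    change ψ.1 ((ν.1 b • (1 : A), b) : A × B) = _
    rw [h, map_add, map_smul, smul_eq_mul]
  have h3 : ψ.1 (a, b) = ψ.1 (a, 0) + ψ.1 (0, b) := by
    rw [← map_add]; simp
  rw [h1, h2, h3]
  ring

/-- The state `φ ∘ f` for `f` a unital *-morphism. -/
noncomputable def stateMap {D : Type*} [CStarAlgebra D] (f : A →⋆ₐ[ℂ] D) :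
    stateSpace D → stateSpace A :=
  stateComp ⟨f.toAlgHom.toLinearMap, map_continuous f⟩ (map_one f)
    fun a => ⟨f a, by change f (star a * a) = _; rw [map_mul, map_star]⟩

theorem stateMap_apply {D : Type*} [CStarAlgebra D] (f : A →⋆ₐ[ℂ] D) (φ : stateSpace D) (a : A) :
    (stateMap f φ).1 a = φ.1 (f a) := rfl

/-- Choosing μ = ν ∘ α reduces the correction terms to ν (b - α a) times the change in weight, and
|ν (b - α a)| ≤ ε on the unit ball. -/
theorem mkMetric_tunnelNorm_le (hε : 0 < ε) (ν : stateSpace B) (φ ψ : stateSpace (A × B)) :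
    mkMetric (tunnelNorm α LA LB ε) φ ψ ≤
      mkMetric LA (stateLeft (stateMap α ν) φ) (stateLeft (stateMap α ν) ψ)
      + mkMetric LB (stateRight ν φ) (stateRight ν ψ) + ε * edist (φ.1 (1, 0)) (ψ.1 (1, 0)) := by
  refine iSup₂_le fun d hd => ?_
  obtain ⟨a, b, rfl⟩ := exists_eq_pairSA d
  have hn := norm_sub_le_of_tunnelNorm_le_one hε hd
  have hA : LA a ≤ 1 := (le_max_left _ _).trans hd
  have hB : LB b ≤ 1 := ((le_max_right _ _).trans (le_max_right _ _)).trans hd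
  have h1 := edist_le_mkMetric (stateLeft (stateMap α ν) φ) (stateLeft (stateMap α ν) ψ) hA
  have h2 := edist_le_mkMetric (stateRight (A := A) ν φ) (stateRight ν ψ) hB
  refine le_trans ?_ (add_le_add (add_le_add h1 h2) le_rfl)
  have hν : ‖ν.1 (b : B) - ν.1 (α a)‖ₑ ≤ ε := by
    rw [← map_sub, enorm_eq_nnnorm, ENNReal.coe_le_coe]
    refine (state_norm_le ν (b - saMap α a).2).trans ?_
    rw [← norm_neg]
    change ‖-((b : B) - α a)‖ ≤ _
    rw [neg_sub]
    exact hn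
  have key : φ.1 ((a : A), (b : B)) - ψ.1 ((a : A), (b : B))
      = ((stateLeft (stateMap α ν) φ).1 (a : A) - (stateLeft (stateMap α ν) ψ).1 (a : A))
        + ((stateRight ν φ).1 (b : B) - (stateRight ν ψ).1 (b : B))
        + -((ν.1 (b : B) - ν.1 (α a)) * (φ.1 (1, 0) - ψ.1 (1, 0))) := by
    rw [state_pair_eq (stateMap α ν) ν φ, state_pair_eq (stateMap α ν) ν ψ, stateMap_apply]
    ring
  change edist (φ.1 ((a : A), (b : B))) (ψ.1 ((a : A), (b : B))) ≤ _
  simp only [edist_eq_enorm_sub]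
  rw [key]
  refine (enorm_add_le _ _).trans (add_le_add (enorm_add_le _ _) ?_)
  rw [enorm_neg, enorm_mul]
  gcongr

/-- The state `b ↦ ψ (α⁻¹ (E b), b)`. -/
noncomputable def stateExp (hα : Function.Injective α) (E : CondExp α.range) :
    stateSpace (A × B) → stateSpace B :=
  stateComp ((pullCLM α hα E).prod (ContinuousLinearMap.id ℂ B))
    (Prod.ext (pullCLM_one α hα E) rfl) fun b => by
      obtain ⟨d, hd⟩ := pullCLM_pos α hα E b
      exact ⟨(d, b), Prod.ext hd rfl⟩

/-- The state `a ↦ ψ (a, α a)`. -/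
noncomputable def stateGraph (α : A →⋆ₐ[ℂ] B) : stateSpace (A × B) → stateSpace A :=
  stateMap ((StarAlgHom.id ℂ A).prod α)

theorem isLipNorm_tunnelNorm (hLA : IsLipNorm LA) (hLB : IsLipNorm LB)
    (hα : Function.Injective α) (E : CondExp α.range) (hε : 0 < ε) :
    IsLipNorm (tunnelNorm α LA LB ε) := by
  refine IsLipNorm.of_tendsto ?_ (dense_tunnelNorm hLA.dense_domain hLB.dense_domain)
    (fun d => ⟨fun h => ?_, ?_⟩) (fun φ ψ => ?_) (fun φ => ?_) ?_
  · rw [tunnelNorm_eq]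
    exact hLA.seminorm.max_norm hLB.seminorm _ _ _ ε
  · obtain ⟨a, b, rfl⟩ := exists_eq_pairSA d
    have hA : LA a = 0 := le_zero_iff.1 ((le_max_left _ _).trans h.le)
    obtain ⟨t, rfl⟩ := (hLA.eq_zero_iff a).1 hA
    have h1 := ((le_max_left _ _).trans (le_max_right _ _)).trans h.le
    -- The gap term vanishes, so b = α a is the same scalar as a.
    have h2 : α ((t • (1 : selfAdjoint A) : selfAdjoint A) : A) - b = 0 := by
      have := nnnorm_le_of_div_le hε ENNReal.zero_ne_top h1
      rw [ENNReal.toNNReal_zero, mul_zero, le_zero_iff] at this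
      exact nnnorm_eq_zero.1 this
    refine ⟨t, Subtype.ext (Prod.ext rfl ?_)⟩
    change (b : B) = t • (1 : B)
    rw [← sub_eq_zero.1 h2]
    change α (t • (1 : A)) = _
    rw [← Complex.coe_smul, map_smul, map_one, Complex.coe_smul]
  · rintro ⟨t, rfl⟩
    have h1 : t • (1 : selfAdjoint (A × B)) = pairSA (t • 1) (t • 1) := rfl
    have h2 : saMap α (t • 1) = t • 1 := by
      rw [← saMapCLM_apply, _root_.map_smul, saMapCLM_apply]
      congr 1
      exact Subtype.ext (map_one α)
    rw [h1, tunnelNorm_pairSA, (hLA.eq_zero_iff _).2 ⟨t, rfl⟩, (hLB.eq_zero_iff _).2 ⟨t, rfl⟩, h2]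
    simp
  · refine ((mkMetric_tunnelNorm_le hε (stateExp hα E φ) φ ψ).trans_lt ?_).ne
    exact ENNReal.add_lt_top.2 ⟨ENNReal.add_lt_top.2 ⟨(hLA.mk_ne_top _ _).lt_top,
      (hLB.mk_ne_top _ _).lt_top⟩, ENNReal.mul_lt_top ENNReal.coe_lt_top (edist_lt_top _ _)⟩
  -- Any reference state of B would serve; this one is manufactured from φ.
  · set ν := stateExp hα E φ
    refine tendsto_of_tendsto_of_tendsto_of_le_of_le tendsto_const_nhds ?_ (fun _ => zero_le)
      (mkMetric_tunnelNorm_le hε ν φ)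
    have h1 := (hLA.tendsto_mkMetric (stateLeft (stateMap α ν) φ)).comp
      ((continuous_stateComp _ _ _).tendsto φ)
    have h2 := (hLB.tendsto_mkMetric (stateRight (A := A) ν φ)).comp
      ((continuous_stateComp _ _ _).tendsto φ)
    have h3 : Tendsto (fun ψ : stateSpace (A × B) => edist (φ.1 (1, 0)) (ψ.1 (1, 0))) (𝓝 φ)
        (𝓝 0) := by
      have hc : Continuous fun ψ : stateSpace (A × B) => ψ.1 ((1, 0) : A × B) :=
        (WeakDual.eval_continuous _).comp continuous_subtype_val
      have := (continuous_const (y := φ.1 ((1, 0) : A × B))).edist hc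
      simpa using this.tendsto φ
    have h4 := ENNReal.Tendsto.const_mul (a := (ε : ℝ≥0∞)) h3 (Or.inr ENNReal.coe_ne_top)
    simpa using! (h1.add h2).add h4
  · rw [tunnelNorm_eq]
    exact isClosed_ball_max_norm hLA.isClosed_ball hLB.isClosed_ball _ _ _ ε

theorem isLeibniz_tunnelNorm {G : ℝ≥0 × ℝ≥0 × ℝ≥0 × ℝ≥0 → ℝ≥0} (hG : ∀ p, leibnizTwo p ≤ G p)
    (hLA : IsLeibnizQCMS G LA) (hLB : IsLeibnizQCMS G LB)
    (hα : Function.Injective α) (E : CondExp α.range) (hε : 0 < ε) :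
    IsLeibnizQCMS G (tunnelNorm α LA LB ε) where
  monotone := hLA.monotone
  isLipNorm := isLipNorm_tunnelNorm hLA.isLipNorm hLB.isLipNorm hα E hε
  leibniz d d' hd hd' := by
    rw [max_realPart_imaginaryPart_le_iff]
    intro s hs
    obtain ⟨a, b, rfl⟩ := exists_eq_pairSA d
    obtain ⟨a', b', rfl⟩ := exists_eq_pairSA d'
    have hA : ∀ x y, LA x ≤ tunnelNorm α LA LB ε (pairSA x y) := fun _ _ => le_max_left _ _
    have hB : ∀ x y, LB y ≤ tunnelNorm α LA LB ε (pairSA x y) := fun _ _ =>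
      (le_max_right _ _).trans (le_max_right _ _)
    have hAn : ∀ (x : selfAdjoint A) (y : selfAdjoint B), ‖x‖₊ ≤ ‖pairSA x y‖₊ := fun x y =>
      norm_fst_le (pairSA x y : A × B)
    have hBn : ∀ (x : selfAdjoint A) (y : selfAdjoint B), ‖y‖₊ ≤ ‖pairSA x y‖₊ := fun x y =>
      norm_snd_le (pairSA x y : A × B)
    have hAB : ∀ x y, tunnelNorm α LA LB ε (pairSA x y) ≠ ∞ → ‖saMap α x - y‖₊ ≤
        ε * (tunnelNorm α LA LB ε (pairSA x y)).toNNReal := fun x y h =>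
      nnnorm_le_of_div_le hε h ((le_max_left _ _).trans (le_max_right _ _))
    have h1 : saMap (StarAlgHom.fst ℂ A B) (realPart (s • ((pairSA a b : A × B) * pairSA a' b')))
        = realPart (s • ((a : A) * a')) := saMap_realPart_smul_mul _ _ _ _
    have h2 : saMap (StarAlgHom.snd ℂ A B) (realPart (s • ((pairSA a b : A × B) * pairSA a' b')))
        = realPart (s • ((b : B) * b')) := saMap_realPart_smul_mul _ _ _ _
    rw [tunnelNorm, h1, h2]
    refine max_le ?_ (max_le ?_ ?_)
    · refine (max_realPart_imaginaryPart_le_iff.1 (hLA.leibniz a a'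
        ((hA _ _).trans_lt hd.lt_top).ne ((hA _ _).trans_lt hd'.lt_top).ne) s hs).trans ?_
      exact ENNReal.coe_le_coe.2 (hLA.monotone ⟨hAn _ _, hAn _ _,
        ENNReal.toNNReal_mono hd (hA _ _), ENNReal.toNNReal_mono hd' (hA _ _)⟩)
    · refine (div_le_coe_of_nnnorm_le hε ?_).trans (ENNReal.coe_le_coe.2 (hG _))
      have h3 := hAB _ _ hd
      have h4 := hAB _ _ hd'
      have h5 := hAn a b
      have h6 := hBn a' b'
      have h7 : saMap α (realPart (s • ((a : A) * a'))) - realPart (s • ((b : B) * b'))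
          = realPart (s • (α a * α a' - (b : B) * b')) := by
        rw [saMap_realPart_smul_mul, smul_sub, map_sub]
      have h8 : ‖α a * α a' - (b : B) * b'‖
          ≤ ‖a‖ * ‖saMap α a' - b'‖ + ‖saMap α a - b‖ * ‖b'‖ := by
        have h9 : α a * α a' - (b : B) * b' = α a * (α a' - b') + (α a - b) * b' := by
          noncomm_ring
        rw [h9, show ‖a‖ = ‖α a‖ from (NonUnitalStarAlgHom.norm_map α hα (a : A)).symm]
        exact (norm_add_le _ _).trans (add_le_add (norm_mul_le _ _) (norm_mul_le _ _))
      rw [h7]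
      have h10 : ‖realPart (s • (α a * α a' - (b : B) * b'))‖₊
          ≤ ‖a‖₊ * ‖saMap α a' - b'‖₊ + ‖saMap α a - b‖₊ * ‖b'‖₊ :=
        (norm_realPart_smul_le hs _).trans h8
      refine h10.trans ((add_le_add (mul_le_mul' h5 h4) (mul_le_mul' h3 h6)).trans ?_)
      set l := (tunnelNorm α LA LB ε (pairSA a b)).toNNReal
      set l' := (tunnelNorm α LA LB ε (pairSA a' b')).toNNReal
      -- The gap term needs only the constant 1 here; the constant 2 of F₂₀ is forced by the
      -- estimate for Lᵋ.
      calc ‖pairSA a b‖₊ * (ε * l') + ε * l * ‖pairSA a' b'‖₊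
          = ε * (1 * (‖pairSA a b‖₊ * l' + ‖pairSA a' b'‖₊ * l)) := by ring
        _ ≤ ε * (2 * (‖pairSA a b‖₊ * l' + ‖pairSA a' b'‖₊ * l)) := by
          gcongr
          exact one_le_two
    · refine (max_realPart_imaginaryPart_le_iff.1 (hLB.leibniz b b'
        ((hB _ _).trans_lt hd.lt_top).ne ((hB _ _).trans_lt hd'.lt_top).ne) s hs).trans ?_
      exact ENNReal.coe_le_coe.2 (hLA.monotone ⟨hBn _ _, hBn _ _,
        ENNReal.toNNReal_mono hd (hB _ _), ENNReal.toNNReal_mono hd' (hB _ _)⟩)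

theorem isQuantumIsometry_fst (h : ∀ a, LB (saMap α a) ≤ LA a) :
    IsQuantumIsometry (tunnelNorm α LA LB ε) LA (StarAlgHom.fst ℂ A B) where
  surjective a := ⟨(a, 0), rfl⟩
  quotient a := by
    refine le_antisymm (le_iInf₂ fun d hd => ?_) (iInf₂_le_of_le (pairSA a (saMap α a)) rfl ?_)
    · rw [← hd]
      exact le_max_left _ _
    · simp [tunnelNorm_pairSA, h a]

/-- The lift (α⁻¹ (E b), b) attains the infimum; the two hypotheses are the two lower bounds built
into Lᵋ. -/
theorem isQuantumIsometry_snd (hα : Function.Injective α) (E : CondExp α.range)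
    (h1 : ∀ b, LA (pullExp α hα E b) ≤ LB b)
    (h2 : ∀ b, ((‖b - E.onSA b‖₊ / ε : ℝ≥0) : ℝ≥0∞) ≤ LB b) :
    IsQuantumIsometry (tunnelNorm α LA LB ε) LB (StarAlgHom.snd ℂ A B) where
  surjective b := ⟨(0, b), rfl⟩
  quotient b := by
    refine le_antisymm (le_iInf₂ fun d hd => ?_)
      (iInf₂_le_of_le (pairSA (pullExp α hα E b) b) rfl ?_)
    · rw [← hd]
      exact (le_max_right _ _).trans (le_max_right _ _)
    · rw [tunnelNorm_pairSA, saMap_pullExp, ← neg_sub, nnnorm_neg]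
      exact max_le (h1 b) (max_le (h2 b) le_rfl)

theorem hausdorff_univ_le {D : Type*} [CStarAlgebra D] {L : selfAdjoint D → ℝ≥0∞}
    {S : Set (stateSpace D)} {r : ℝ≥0∞} (h : ∀ ψ, ∃ χ ∈ S, mkMetric L ψ χ ≤ r) :
    hausdorff (mkMetric L) Set.univ S ≤ r := by
  refine max_le (iSup₂_le fun ψ _ => ?_) (iSup₂_le fun χ _ => ?_)
  · obtain ⟨χ, hχ, hr⟩ := h ψ
    exact iInf₂_le_of_le χ hχ hr
  · exact iInf₂_le_of_le χ (Set.mem_univ χ) ((mkMetric_self L χ).le.trans zero_le)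

theorem hausdorff_fst_le (hε : 0 < ε) :
    hausdorff (mkMetric (tunnelNorm α LA LB ε)) Set.univ
      (pullbackStates (StarAlgHom.fst ℂ A B)) ≤ ε := by
  refine hausdorff_univ_le fun ψ => ⟨stateMap (StarAlgHom.fst ℂ A B) (stateGraph α ψ),
    ⟨stateGraph α ψ, fun _ => rfl⟩, iSup₂_le fun d hd => ?_⟩
  obtain ⟨a, b, rfl⟩ := exists_eq_pairSA d
  have hn := norm_sub_le_of_tunnelNorm_le_one hε hd
  change edist (ψ.1 ((a : A), (b : B))) (ψ.1 ((a : A), α a)) ≤ _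
  rw [edist_eq_enorm_sub, ← map_sub, enorm_eq_nnnorm, ENNReal.coe_le_coe]
  refine (state_norm_le ψ (pairSA a b - pairSA a (saMap α a)).2).trans ?_
  change max ‖(a : A) - a‖ ‖(b : B) - α a‖ ≤ _
  rw [sub_self, norm_zero, norm_sub_rev]
  exact max_le ε.2 hn

theorem hausdorff_snd_le (hα : Function.Injective α) (E : CondExp α.range) (hε : 0 < ε) :
    hausdorff (mkMetric (tunnelNorm α LA LB ε)) Set.univ
      (pullbackStates (StarAlgHom.snd ℂ A B)) ≤ ε := by
  refine hausdorff_univ_le fun ψ => ⟨stateMap (StarAlgHom.snd ℂ A B) (stateExp hα E ψ),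
    ⟨stateExp hα E ψ, fun _ => rfl⟩, iSup₂_le fun d hd => ?_⟩
  obtain ⟨a, b, rfl⟩ := exists_eq_pairSA d
  have hn := norm_sub_le_of_tunnelNorm_le_one hε hd
  change edist (ψ.1 ((a : A), (b : B))) (ψ.1 (pullCLM α hα E b, (b : B))) ≤ _
  rw [edist_eq_enorm_sub, ← map_sub, enorm_eq_nnnorm, ENNReal.coe_le_coe]
  refine (state_norm_le ψ (pairSA a b - pairSA (pullExp α hα E b) b).2).trans ?_
  change max ‖(a : A) - pullCLM α hα E b‖ ‖(b : B) - b‖ ≤ _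
  rw [sub_self, norm_zero]
  refine max_le ?_ ε.2
  -- As α⁻¹ ∘ E sends α a to a, the first coordinate a - α⁻¹ (E b) is the image of α a - b under a
  -- contraction.
  have h := norm_pullCLM_le α hα E (α a - b)
  rw [map_sub, pullCLM_map] at h
  exact h.trans hn

end TunnelNorm

end QuantumMetric

open scoped NNReal ENNReal in
theorem mainTheorem8 {A : Type*} {B : Type*} [CStarAlgebra A] [CStarAlgebra B]
    (F : ℝ≥0 × ℝ≥0 × ℝ≥0 × ℝ≥0 → ℝ≥0)
    (LA : selfAdjoint A → ℝ≥0∞) (LB : selfAdjoint B → ℝ≥0∞)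
    (hLA : QuantumMetric.IsLipNorm LA) (hLB : QuantumMetric.IsLeibnizQCMS F LB)
    (α : A →⋆ₐ[ℂ] B) (hα : Function.Injective α)
    (E : QuantumMetric.CondExp α.range)
    (m : ℝ≥0) (hm : 0 < m)
    (hα_lower : ∀ a : selfAdjoint A, m * LA a ≤ LB (QuantumMetric.saMap α a))
    (hα_upper : ∀ a : selfAdjoint A, LB (QuantumMetric.saMap α a) ≤ LA a)
    (hE : ∀ b : selfAdjoint B, LB (E.onSA b) ≤ LB b)
    (ε : ℝ≥0) (hε : 0 < ε) :
    QuantumMetric.IsLeibnizQCMS (QuantumMetric.leibnizBound m F) LA ∧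
    QuantumMetric.IsLeibnizQCMS (QuantumMetric.leibnizBound m F)
      (QuantumMetric.modifiedSeminorm α hα E LA LB ε) ∧
    QuantumMetric.propinquity (QuantumMetric.leibnizBound m F) LA
      (QuantumMetric.modifiedSeminorm α hα E LA LB ε) ≤ ε := by
  have hA := QuantumMetric.leibniz_of_bilipschitz hα hLB hLA hm hα_lower hα_upper
  have hB := QuantumMetric.isLeibniz_modifiedSeminorm hα E hLA hLB hm hα_lower hα_upper hE hε
  refine ⟨hA, hB, ?_⟩
  let τ : QuantumMetric.Tunnel (QuantumMetric.leibnizBound m F) LA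
      (QuantumMetric.modifiedSeminorm α hα E LA LB ε) :=
    { D := A × B
      L := QuantumMetric.tunnelNorm α LA (QuantumMetric.modifiedSeminorm α hα E LA LB ε) ε
      isLeibniz := QuantumMetric.isLeibniz_tunnelNorm (fun _ => le_max_right _ _) hA hB hα E hε
      πA := StarAlgHom.fst ℂ A B
      πB := StarAlgHom.snd ℂ A B
      isometryA := QuantumMetric.isQuantumIsometry_fst fun a =>
        (QuantumMetric.modifiedSeminorm_saMap hα E hα_upper a).le
      isometryB := QuantumMetric.isQuantumIsometry_snd hα E
        (QuantumMetric.pullExp_le_modifiedSeminorm hα E)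
        (QuantumMetric.norm_div_le_modifiedSeminorm hα E) }
  exact iInf_le_of_le τ (max_le (QuantumMetric.hausdorff_fst_le hε)
    (QuantumMetric.hausdorff_snd_le hα E hε))
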